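/- Let $R$ be a commutative ring with identity. A finitely generated ideal $J$ of $R$ is a GV-ideal if the natural map $R\to \mathrm{Hom}_R(J,R)$, $r\mapsto (x\mapsto rx)$, is an isomorphism. For an $R$-module $X$ let $\mathrm{tor}_{GV}(X)=\{x\in X : Jx=0 \text{ for some GV-ideal } J\}$; $X$ is GV-torsion if $\mathrm{tor}_{GV}(X)=X$ and GV-torsionfree if $\mathrm{tor}_{GV}(X)=0$. A $w$-module is a GV-torsionfree module $X$ with $\mathrm{Ext}^1_R(R/J,X)=0$ for all GV-ideals $J$. For $X$ GV-torsionfree with injective envelope $E(X)$, put $X_w=\{x\in E(X): Jx\subseteq X\text{ for some GV-ideal }J\}$, and for any module $X$ put $L(X)=(X/\mathrm{tor}_{GV}(X))_w$. $X$ is $w$-projective if $\mathrm{Ext}^1_R(L(X),N)$ is GV-torsion for every $w$-module $N$ that is torsionfree (regular elements of $R$ act injectively on $N$). A homomorphism is a $w$-isomorphism if its localization at every maximal $w$-ideal (an ideal maximal among the proper ideals that are $w$-modules) is an isomorphism; $X$ is $w$-countably generated if there is a $w$-isomorphism $X_0\to X$ with $X_0$ countably generated. A short exact sequence $0\to A\to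 B\xrightarrow{g} C\to 0$ is $w$-split if there are $d_1,\dots,d_n\in R$ generating a GV-ideal and homomorphisms $h_1,\dots,h_n:C\to B$ with $g h_k=d_k\cdot \mathrm{id}_C$ for all $k$. A module $X$ is $w$-split if there is a $w$-split exact sequence $0\to K\to P\to X\to 0$ with $P$ projective. A $w$-split presentation $\xi$ of $M$ consists of a $w$-split exact sequence $0\to P\to F\xrightarrow{g} M\to 0$ with chosen $d_k$ and $h_k$ as above, and a decomposition $F=\bigoplus_{i\in I}F_i$ into countably generated projective submodules. For $H\subseteq I$ write $F(H)=\bigoplus_{i\in H}F_i$ and $M(H)=g(F(H))$. A continuous chain of submodules $(A_\lambda)_{\lambda\le\alpha}$, $\alpha$ an ordinal, satisfies $A_0=0$, $A_\lambda\subseteq A_{\lambda+1}$ for $\lambda<\alpha$, and $A_\lambda=\bigcup_{\mu<\lambda}A_\mu$ for limit ordinals $\lambda\le\alpha$. Theorem. Let $M$ be a $w$-projective $w$-module over $R$. Then: (1) $M$ can be filtered by countably generated $w$-split modules: $M$ has a $w$-split presentation, and for every $w$-split presentation $\xi$ of $M$ there are an ordinal $\alpha$, a subset $H\subseteq I$ and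 subsets $H_\lambda\subseteq H$ ($\lambda\le\alpha$) with $H_0=\emptyset$, $H_\alpha=H$, such that $(M(H_\lambda))_{\lambda\le\alpha}$ is a continuous chain with $M(H_\alpha)=M$; $h_k(M(H_\lambda))\subseteq F(H_\lambda)$ for all $k$ and all $\lambda\le\alpha$ (that is, $M(H_\lambda)$ is a $w$-split module induced by $\xi$ with respect to $H_\lambda$); and for each $\lambda<\alpha$ the module $M(H_{\lambda+1})/M(H_\lambda)$ is countably generated and $w$-split. (2) $M$ can be filtered by $w$-countably generated $w$-projective modules: there are an ordinal $\alpha$ and a continuous chain $(M'_\lambda)_{\lambda\le\alpha}$ of submodules of $M$ with $M'_\alpha=M$, such that each $M'_\lambda$ is a $w$-projective $w$-module and, for each $\lambda<\alpha$, $M'_{\lambda+1}/M'_\lambda$ is $w$-countably generated and $w$-projective. -/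

import Mathlib

universe u

open CategoryTheory

noncomputable section

namespace WKaplansky

/-! ### Glaz-Vasconcelos ideals and the torsion theory they define -/

section GV

variable {R : Type u} [CommRing R]

/-- `J` is a GV-ideal: `J` is finitely generated and the natural map
`R → Hom_R(J, R)`, `r ↦ (x ↦ r x)`, is an isomorphism. -/
def IsGVIdeal (J : Ideal R) : Prop :=
  J.FG ∧ Function.Bijective (LinearMap.toSpanSingleton R (J →ₗ[R] R) J.subtype)

theorem isGVIdeal_top : IsGVIdeal (⊤ : Ideal R) := by
  refine ⟨Ideal.fg_top R, ?_, ?_⟩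
  · intro r s h
    simpa using LinearMap.congr_fun h ⟨1, trivial⟩
  · intro φ
    refine ⟨φ ⟨1, trivial⟩, ?_⟩
    ext ⟨x, hx⟩
    have h1 : (⟨x, hx⟩ : (⊤ : Ideal R)) = x • ⟨1, trivial⟩ := by ext; simp
    rw [h1, map_smul, LinearMap.toSpanSingleton_apply, map_smul]
    simp [mul_comm]

theorem IsGVIdeal.eq_zero {J : Ideal R} (hJ : IsGVIdeal J) {r : R}
    (h : ∀ x ∈ J, r * x = 0) : r = 0 := by
  apply hJ.2.1
  ext ⟨x, hx⟩
  simpa using h x hx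

theorem IsGVIdeal.exists_mul {J : Ideal R} (hJ : IsGVIdeal J) (φ : J →ₗ[R] R) :
    ∃ r : R, ∀ x : J, φ x = r * x := by
  obtain ⟨r, hr⟩ := hJ.2.2 φ
  exact ⟨r, fun x => by rw [← hr]; simp⟩

theorem IsGVIdeal.mul {J K : Ideal R} (hJ : IsGVIdeal J) (hK : IsGVIdeal K) :
    IsGVIdeal (J * K) := by
  refine ⟨hJ.1.mul hK.1, ?_, ?_⟩
  · rw [injective_iff_map_eq_zero]
    intro r hr
    refine hJ.eq_zero fun a ha => hK.eq_zero fun b hb => ?_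
    have := LinearMap.congr_fun hr ⟨a * b, Ideal.mul_mem_mul ha hb⟩
    simpa [mul_assoc] using this
  · intro φ
    have h1 : ∀ a : J, ∃ c : R, ∀ b : K,
        φ ⟨a * b, Ideal.mul_mem_mul a.2 b.2⟩ = c * b := by
      intro a
      obtain ⟨c, hc⟩ := hK.exists_mul
        { toFun := fun b : K => φ ⟨a * b, Ideal.mul_mem_mul a.2 b.2⟩
          map_add' := fun x y => by
            rw [← map_add]; congr 1; ext; simp [mul_add]
          map_smul' := fun t x => by
            rw [RingHom.id_apply, ← map_smul]; congr 1; ext; simp [mul_left_comm] }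
      exact ⟨c, hc⟩
    choose c hc using h1
    have key : ∀ s t : R, (∀ b : K, s * b = t * b) → s = t := fun s t h =>
      sub_eq_zero.1 (hK.eq_zero fun x hx => by rw [sub_mul, h ⟨x, hx⟩, sub_self])
    obtain ⟨r, hr⟩ := hJ.exists_mul
      { toFun := c
        map_add' := fun x y => key _ _ fun b => by
          rw [add_mul, ← hc, ← hc, ← hc, ← map_add]; congr 1; ext; simp [add_mul]
        map_smul' := fun t x => key _ _ fun b => by
          rw [RingHom.id_apply, smul_eq_mul, mul_assoc, ← hc x, ← hc (t • x), ← smul_eq_mul t,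
            ← φ.map_smul]
          congr 1; ext; simp [mul_assoc] }
    refine ⟨r, ?_⟩
    ext ⟨x, hx⟩
    simp only [LinearMap.toSpanSingleton_apply, LinearMap.smul_apply, Submodule.subtype_apply,
      smul_eq_mul]
    induction hx using Submodule.mul_induction_on' with
    | mem_mul_mem a ha b hb =>
      have h2 := hr ⟨a, ha⟩
      have h3 := hc ⟨a, ha⟩ ⟨b, hb⟩
      simp only [LinearMap.coe_mk, AddHom.coe_mk] at h2
      rw [h3, h2, mul_assoc]
    | add x hx y hy h4 h5 =>
      have : (⟨x + y, add_mem hx hy⟩ : ↥(J * K)) = ⟨x, hx⟩ + ⟨y, hy⟩ := rfl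
      rw [this, map_add, ← h4, ← h5, mul_add]

variable {M : Type*} [AddCommGroup M] [Module R M]

/-- For a submodule `N` of `E`, the submodule `{x ∈ E | J x ⊆ N for some GV-ideal J}`. -/
def gvClosure (N : Submodule R M) : Submodule R M where
  carrier := {x | ∃ J : Ideal R, IsGVIdeal J ∧ ∀ a ∈ J, a • x ∈ N}
  zero_mem' := ⟨⊤, isGVIdeal_top, fun a _ => by rw [smul_zero]; exact N.zero_mem⟩
  add_mem' := fun {x y} ⟨J, hJ, hx⟩ ⟨K, hK, hy⟩ =>
    ⟨J * K, hJ.mul hK, fun a ha => by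
      rw [smul_add]
      exact N.add_mem (hx a ((Ideal.mul_le_inf ha).1)) (hy a ((Ideal.mul_le_inf ha).2))⟩
  smul_mem' := fun r x ⟨J, hJ, hx⟩ =>
    ⟨J, hJ, fun a ha => by rw [smul_comm]; exact N.smul_mem r (hx a ha)⟩

variable (R M)

/-- `tor_GV(M) = {x ∈ M | J x = 0 for some GV-ideal J}`. -/
def torGV : Submodule R M := gvClosure ⊥

/-- `M` is GV-torsion: `tor_GV(M) = M`. -/
def IsGVTorsion : Prop := torGV R M = ⊤

/-- `M` is GV-torsionfree: `tor_GV(M) = 0`. -/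
def IsGVTorsionFree : Prop := torGV R M = ⊥

/-- `M` is generated by a countable (possibly finite or empty) set. -/
def IsCountablyGenerated : Prop :=
  ∃ s : Set M, s.Countable ∧ Submodule.span R s = ⊤

end GV

/-! ### `w`-modules, `w`-envelopes and `w`-projective modules -/

section WModules

variable (R : Type u) [CommRing R] (M : Type u) [AddCommGroup M] [Module R M]

/-- `M` is a `w`-module: it is GV-torsionfree and `Ext¹_R(R/J, M) = 0` for all GV-ideals `J`. -/
def IsWModule : Prop :=
  IsGVTorsionFree R M ∧ ∀ J : Ideal R, IsGVIdeal J →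
    Subsingleton (Abelian.Ext (ModuleCat.of R (R ⧸ J)) (ModuleCat.of R M) 1)

variable {R M} in
/-- The embedding `j : M → E` makes `E` an injective envelope of `M`: `E` is injective and
every nonzero submodule of `E` meets the image of `M`. -/
def IsInjectiveEnvelope {E : Type u} [AddCommGroup E] [Module R E] (j : M →ₗ[R] E) : Prop :=
  Module.Injective R E ∧ Function.Injective j ∧
    ∀ S : Submodule R E, S ⊓ LinearMap.range j = ⊥ → S = ⊥

variable {R M} in
/-- The `w`-envelope `M_w = {x ∈ E(M) | J x ⊆ M for some GV-ideal J}` of `M`, formed inside an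
injective envelope `j : M → E(M)`. -/
def wEnvelope {E : Type u} [AddCommGroup E] [Module R E] (j : M →ₗ[R] E) : Submodule R E :=
  gvClosure (LinearMap.range j)

/-- `M` is `w`-projective: with `L(M) = (M / tor_GV(M))_w`, the module `Ext¹_R(L(M), N)` is
GV-torsion for every `w`-module `N` that is torsionfree (regular elements of `R` act
injectively). Injective envelopes exist and are unique up to isomorphism over the module, so
`L(M)` may be formed in any one of them. -/
def IsWProjective : Prop :=
  ∃ (E : Type u) (_ : AddCommGroup E) (_ : Module R E) (j : (M ⧸ torGV R M) →ₗ[R] E),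
    IsInjectiveEnvelope j ∧
    ∀ (N : Type u) [AddCommGroup N] [Module R N], Module.IsTorsionFree R N → IsWModule R N →
      IsGVTorsion R (Abelian.Ext (ModuleCat.of R (wEnvelope j)) (ModuleCat.of R N) 1)

end WModules

/-! ### `w`-isomorphisms and `w`-countably generated modules -/

section WIso

variable {R : Type u} [CommRing R]

/-- A maximal `w`-ideal: an ideal maximal among the proper ideals that are `w`-modules. -/
def IsMaximalWIdeal (m : Ideal R) : Prop :=
  Maximal (fun I : Ideal R => I ≠ ⊤ ∧ IsWModule R I) m

/-- `f` is a `w`-isomorphism: `f_m` is an isomorphism for every maximal `w`-ideal `m`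
(maximal `w`-ideals are prime, so that one can localize at them). -/
def IsWIsomorphism {M N : Type u} [AddCommGroup M] [Module R M] [AddCommGroup N] [Module R N]
    (f : M →ₗ[R] N) : Prop :=
  ∀ (m : Ideal R) [m.IsPrime], IsMaximalWIdeal m →
    Function.Bijective (LocalizedModule.map m.primeCompl f)

variable (R) in
/-- `M` is `w`-countably generated: some countably generated module has a `w`-isomorphism
to `M`. -/
def IsWCountablyGenerated (M : Type u) [AddCommGroup M] [Module R M] : Prop :=
  ∃ (M₀ : Type u) (_ : AddCommGroup M₀) (_ : Module R M₀) (f : M₀ →ₗ[R] M),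
    IsCountablyGenerated R M₀ ∧ IsWIsomorphism f

end WIso

/-! ### `w`-split sequences and modules -/

section WSplit

variable {R : Type u} [CommRing R]

/-- The elements `d₁, …, dₙ` generate a GV-ideal, and the maps `h₁, …, hₙ : C → B` satisfy
`g ∘ hₖ = dₖ · id_C` for all `k`. -/
def IsWSplitting {B C : Type u} [AddCommGroup B] [Module R B] [AddCommGroup C] [Module R C]
    (g : B →ₗ[R] C) {n : ℕ} (d : Fin n → R) (h : Fin n → C →ₗ[R] B) : Prop :=
  IsGVIdeal (Ideal.span (Set.range d)) ∧ ∀ k, g ∘ₗ h k = d k • LinearMap.id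

/-- `0 → A → B → C → 0` is a `w`-split short exact sequence. -/
def IsWSplitExact {A B C : Type u} [AddCommGroup A] [Module R A] [AddCommGroup B] [Module R B]
    [AddCommGroup C] [Module R C] (f : A →ₗ[R] B) (g : B →ₗ[R] C) : Prop :=
  Function.Injective f ∧ Function.Exact f g ∧ Function.Surjective g ∧
    ∃ (n : ℕ) (d : Fin n → R) (h : Fin n → C →ₗ[R] B), IsWSplitting g d h

variable (R) in
/-- `M` is a `w`-split module: there is a `w`-split short exact sequence `0 → K → P → M → 0`
with `P` projective. -/
def IsWSplit (M : Type u) [AddCommGroup M] [Module R M] : Prop :=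
  ∃ (K : Type u) (_ : AddCommGroup K) (_ : Module R K)
    (P : Type u) (_ : AddCommGroup P) (_ : Module R P)
    (f : K →ₗ[R] P) (g : P →ₗ[R] M), Module.Projective R P ∧ IsWSplitExact f g

end WSplit

/-! ### Filtrations -/

section Filtrations

/-- The submodules `A_l`, `l ≤ α`, form a continuous chain: `A_0 = 0`, `A_l ⊆ A_{l+1}` for
`l < α`, and `A_l = ⋃_{μ < l} A_μ` for limit ordinals `l ≤ α`. -/
def IsContinuousChain {R : Type u} [CommRing R] {M : Type u} [AddCommGroup M] [Module R M]
    (α : Ordinal.{u}) (A : Ordinal.{u} → Submodule R M) : Prop :=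
  A 0 = ⊥ ∧ (∀ l < α, A l ≤ A (l + 1)) ∧
    ∀ l ≤ α, Order.IsSuccLimit l → ∀ x, x ∈ A l ↔ ∃ μ < l, x ∈ A μ

/-- A `w`-split presentation of `M`: a short exact sequence `0 → P → F → M → 0`, together with
elements `d₁, …, dₙ` generating a GV-ideal and maps `h₁, …, hₙ : M → F` showing that it is
`w`-split, and a decomposition of `F` as the internal direct sum of countably generated
projective submodules `F_i`, `i ∈ I`. -/
structure WSplitPresentation (R : Type u) [CommRing R] (M : Type u) [AddCommGroup M]
    [Module R M] where
  P : Type u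
  F : Type u
  [addCommGroupP : AddCommGroup P]
  [moduleP : Module R P]
  [addCommGroupF : AddCommGroup F]
  [moduleF : Module R F]
  f : P →ₗ[R] F
  g : F →ₗ[R] M
  f_injective : Function.Injective f
  exact : Function.Exact f g
  g_surjective : Function.Surjective g
  n : ℕ
  d : Fin n → R
  h : Fin n → M →ₗ[R] F
  splitting : IsWSplitting g d h
  I : Type u
  component : I → Submodule R F
  independent : iSupIndep component
  iSup_component : ⨆ i, component i = ⊤
  projective : ∀ i, Module.Projective R (component i)
  countablyGenerated : ∀ i, IsCountablyGenerated R (component i)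

attribute [instance] WSplitPresentation.addCommGroupP WSplitPresentation.moduleP
  WSplitPresentation.addCommGroupF WSplitPresentation.moduleF

variable {R : Type u} [CommRing R] {M : Type u} [AddCommGroup M] [Module R M]

/-- `F(H) = ⨁_{j ∈ H} F_j ⊆ F`. -/
def WSplitPresentation.subF (ξ : WSplitPresentation R M) (H : Set ξ.I) : Submodule R ξ.F :=
  ⨆ j ∈ H, ξ.component j

/-- `M(H) = g(F(H)) ⊆ M`. -/
def WSplitPresentation.subM (ξ : WSplitPresentation R M) (H : Set ξ.I) : Submodule R M :=
  (ξ.subF H).map ξ.g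

/-- `M(H)` is a `w`-split module induced by `ξ` with respect to `H`: every `h_k` maps `M(H)` into
`F(H)`, that is, the `h_k` restrict to maps showing that
`0 → f⁻¹(ker g ∩ F(H)) → F(H) → M(H) → 0` is `w`-split. -/
def WSplitPresentation.IsInduced (ξ : WSplitPresentation R M) (H : Set ξ.I) : Prop :=
  ∀ k, ξ.subM H ≤ (ξ.subF H).comap (ξ.h k)

/-- The submodule `N` of `M` is filtered, relative to `ξ`, by countably generated `w`-split
modules. The quotient in the last clause is `N_{l+1} / N_l`. -/
def WSplitPresentation.IsFilteredByCGWSplit (ξ : WSplitPresentation R M)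
    (N : Submodule R M) : Prop :=
  ∃ (α : Ordinal.{u}) (H : Set ξ.I) (Hs : Ordinal.{u} → Set ξ.I),
    (∀ l ≤ α, Hs l ⊆ H) ∧ Hs 0 = ∅ ∧ Hs α = H ∧
    IsContinuousChain α (fun l => ξ.subM (Hs l)) ∧ ξ.subM (Hs α) = N ∧
    (∀ l ≤ α, ξ.IsInduced (Hs l)) ∧
    ∀ l < α,
      IsCountablyGenerated R
        (ξ.subM (Hs (l + 1)) ⧸ (ξ.subM (Hs l)).submoduleOf (ξ.subM (Hs (l + 1)))) ∧
      IsWSplit R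
        (ξ.subM (Hs (l + 1)) ⧸ (ξ.subM (Hs l)).submoduleOf (ξ.subM (Hs (l + 1))))

variable (R M) in
/-- `M` is filtered by `w`-countably generated `w`-projective modules: it has a continuous chain
of `w`-projective `w`-submodules ending in `M` whose successive quotients are `w`-countably
generated and `w`-projective. -/
def IsFilteredByWCGWProjective : Prop :=
  ∃ (α : Ordinal.{u}) (A : Ordinal.{u} → Submodule R M),
    IsContinuousChain α A ∧ A α = ⊤ ∧
    (∀ l ≤ α, IsWProjective R (A l) ∧ IsWModule R (A l)) ∧
    ∀ l < α,
      IsWCountablyGenerated R (A (l + 1) ⧸ (A l).submoduleOf (A (l + 1))) ∧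
      IsWProjective R (A (l + 1) ⧸ (A l).submoduleOf (A (l + 1)))

end Filtrations

end WKaplansky

end

/-! Let `M` be a `w`-projective `w`-module and `g : F → M` a free cover. Since `M` is
GV-torsionfree, the kernel is GV-closed in `F`, hence a torsionfree `w`-module, so some GV-ideal
`(d₁, …, dₙ)` kills the class of the cover in `Ext¹`. Each `dₖ · id` therefore lifts to a map `hₖ :
M → F` (`IsWProjective.exists_isWSplitting`). Conversely, if the generators of a GV-ideal act on a
GV-torsionfree `X` through a projective module, they kill `Ext¹(L(X), -)`, and `X` is `w`-projective
(`HasWSplitting.isWProjective`).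

With the `hₖ` in place of a splitting, Kaplansky's argument runs. Each `hₖ(g(Fᵢ))` is countably
generated, so it involves only countably many components, and every index lies in a countable set
closed under this dependence. Well-ordering `I` and uniting these sets gives the `H_λ`
(`exists_filtration`). Both `g` and the `hₖ` descend to maps between `M(H_{λ+1})/M(H_λ)` and the
countably generated projective module `F(H_{λ+1} \ H_λ)` (`exists_quotient_splitting`), which proves
(1).

For (2), `M(H_λ)` is replaced by its GV-closure in `M`. The `hₖ` still map it into `F(H_λ)`, a
GV-closed summand. Chains stay continuous because GV-ideals are finitely generated, and the
successive quotients become GV-torsionfree. -/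

namespace WKaplansky

/-! ### GV-closure, GV-torsionfree modules, and extension of maps from GV-ideals. -/

section GVBasics

variable {R : Type u} [CommRing R] {M N : Type*} [AddCommGroup M] [Module R M]
  [AddCommGroup N] [Module R N]

theorem le_gvClosure (S : Submodule R M) : S ≤ gvClosure S := fun _ hx =>
  ⟨⊤, isGVIdeal_top, fun a _ => S.smul_mem a hx⟩

theorem gvClosure_mono {S T : Submodule R M} (h : S ≤ T) : gvClosure S ≤ gvClosure T :=
  fun _ ⟨J, hJ, hx⟩ => ⟨J, hJ, fun a ha => h (hx a ha)⟩

/-- A finitely generated ideal moves `x` into `S` as soon as its generators do. -/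
theorem smul_mem_of_mem_span_range {n : ℕ} {d : Fin n → R} {S : Submodule R M} {x : M}
    (h : ∀ k, d k • x ∈ S) : ∀ a ∈ Ideal.span (Set.range d), a • x ∈ S := by
  have : Ideal.span (Set.range d) ≤ S.comap (LinearMap.toSpanSingleton R M x) := by
    rw [Ideal.span, Submodule.span_le]
    rintro _ ⟨k, rfl⟩
    simpa using h k
  intro a ha
  simpa using this ha

theorem IsGVIdeal.exists_generators {J : Ideal R} (hJ : IsGVIdeal J) :
    ∃ (n : ℕ) (d : Fin n → R), Ideal.span (Set.range d) = J :=
  Submodule.fg_iff_exists_fin_generating_family.1 hJ.1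

/-- The `gvClosure` of a directed union is the union of the `gvClosure`s. -/
theorem mem_gvClosure_of_directed {ι : Type*} [Nonempty ι] {S : ι → Submodule R M}
    (hS : Directed (· ≤ ·) S) {T : Submodule R M} (hT : ∀ x ∈ T, ∃ i, x ∈ S i) {x : M}
    (hx : x ∈ gvClosure T) : ∃ i, x ∈ gvClosure (S i) := by
  obtain ⟨J, hJ, hJx⟩ := hx
  obtain ⟨n, d, rfl⟩ := hJ.exists_generators
  choose i hi using fun k => hT _ (hJx (d k) (Ideal.subset_span ⟨k, rfl⟩))
  obtain ⟨m, hm⟩ := hS.finite_le i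
  exact ⟨m, _, hJ, smul_mem_of_mem_span_range fun k => hm k (hi k)⟩

/-- Each generator `d k` of `J` needs its own GV-ideal `K k` to bring `d k • x` into `S`; as there
are finitely many, `(∏ K k) * J` is a GV-ideal that works for `x`. -/
theorem gvClosure_idem (S : Submodule R M) : gvClosure (gvClosure S) = gvClosure S := by
  refine le_antisymm ?_ (le_gvClosure _)
  rintro x ⟨J, hJ, hJx⟩
  obtain ⟨n, d, rfl⟩ := hJ.exists_generators
  choose K hK hKx using fun k => hJx (d k) (Ideal.subset_span ⟨k, rfl⟩)
  have hP : ∀ s : Finset (Fin n), IsGVIdeal (∏ k ∈ s, K k) := by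
    intro s
    induction s using Finset.cons_induction with
    | empty => simpa using isGVIdeal_top
    | cons a s ha ih => rw [Finset.prod_cons]; exact (hK a).mul ih
  refine ⟨_, (hP Finset.univ).mul hJ, fun a ha => ?_⟩
  induction ha using Submodule.mul_induction_on' with
  | mem_mul_mem a ha b hb =>
    rw [mul_smul, smul_comm]
    refine smul_mem_of_mem_span_range (fun k => ?_) b hb
    rw [smul_comm]
    exact hKx k a (Ideal.le_of_dvd (Finset.dvd_prod_of_mem K (Finset.mem_univ k)) ha)
  | add a _ b _ h₁ h₂ => rw [add_smul]; exact S.add_mem h₁ h₂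

theorem isGVTorsionFree_iff : IsGVTorsionFree R M ↔
    ∀ (J : Ideal R), IsGVIdeal J → ∀ x : M, (∀ a ∈ J, a • x = 0) → x = 0 := by
  rw [IsGVTorsionFree, eq_bot_iff]
  exact ⟨fun h J hJ x hx => h ⟨J, hJ, hx⟩, fun h x ⟨J, hJ, hx⟩ => h J hJ x hx⟩

theorem IsGVTorsionFree.of_injective (h : IsGVTorsionFree R N) (f : M →ₗ[R] N)
    (hf : Function.Injective f) : IsGVTorsionFree R M := by
  rw [isGVTorsionFree_iff] at h ⊢
  refine fun J hJ x hx => hf ?_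
  rw [map_zero]
  exact h J hJ _ fun a ha => by rw [← map_smul, hx a ha, map_zero]

theorem isGVTorsionFree_quotient {S : Submodule R M} (hS : gvClosure S ≤ S) :
    IsGVTorsionFree R (M ⧸ S) := by
  rw [isGVTorsionFree_iff]
  intro J hJ x hx
  obtain ⟨x, rfl⟩ := S.mkQ_surjective x
  rw [Submodule.mkQ_apply, Submodule.Quotient.mk_eq_zero]
  refine hS ⟨J, hJ, fun a ha => ?_⟩
  rw [← Submodule.Quotient.mk_eq_zero]
  exact hx a ha

/-- A module has the extension property with respect to the inclusions of GV-ideals. -/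
def HasGVExtension (R M : Type*) [CommRing R] [AddCommGroup M] [Module R M] : Prop :=
  ∀ J : Ideal R, IsGVIdeal J → ∀ φ : J →ₗ[R] M, ∃ m : M, ∀ a : J, φ a = (a : R) • m

/-- A map into a `w`-module extends uniquely along an embedding with GV-torsion cokernel. -/
theorem HasGVExtension.exists_extension {X Y : Type*} [AddCommGroup X] [Module R X]
    [AddCommGroup Y] [Module R Y] (h₀ : IsGVTorsionFree R M) (h₁ : HasGVExtension R M)
    (i : X →ₗ[R] Y) (hi : Function.Injective i) (hY : gvClosure (LinearMap.range i) = ⊤)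
    (f : X →ₗ[R] M) : ∃ f' : Y →ₗ[R] M, f' ∘ₗ i = f := by
  -- The GV-closure of the graph of `f` is the graph of the extension: it is single-valued because
  -- `M` is GV-torsionfree, and defined everywhere by the extension property.
  let G : Submodule R (Y × M) := gvClosure (LinearMap.range (i.prod f))
  let p : G →ₗ[R] Y := LinearMap.fst R Y M ∘ₗ G.subtype
  have hp : Function.Bijective p := by
    refine ⟨(injective_iff_map_eq_zero p).2 ?_, fun y => ?_⟩
    · rintro ⟨⟨y, w⟩, J, hJ, hG⟩ (rfl : y = 0)
      suffices w = 0 by subst this; rfl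
      refine isGVTorsionFree_iff.1 h₀ J hJ w fun a ha => ?_
      obtain ⟨x, hx⟩ := hG a ha
      have hx₁ : i x = a • 0 := congrArg Prod.fst hx
      have hx₂ : f x = a • w := congrArg Prod.snd hx
      rw [smul_zero] at hx₁
      rw [← hx₂, hi (hx₁.trans (map_zero i).symm), map_zero]
    · obtain ⟨J, hJ, hJy⟩ : y ∈ gvClosure (LinearMap.range i) := hY ▸ trivial
      let e := LinearEquiv.ofInjective i hi
      let ψ : J →ₗ[R] LinearMap.range i :=
        LinearMap.codRestrict _ (LinearMap.toSpanSingleton R Y y ∘ₗ J.subtype)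
          fun a => by simpa using hJy a a.2
      obtain ⟨m, hm⟩ := h₁ J hJ (f ∘ₗ e.symm.toLinearMap ∘ₗ ψ)
      refine ⟨⟨(y, m), J, hJ, fun a ha => ⟨e.symm (ψ ⟨a, ha⟩), ?_⟩⟩, rfl⟩
      have h₂ : i (e.symm (ψ ⟨a, ha⟩)) = a • y := by
        rw [← LinearEquiv.ofInjective_apply (h := hi), e.apply_symm_apply]; rfl
      exact Prod.ext h₂ (hm ⟨a, ha⟩)
  let e := LinearEquiv.ofBijective p hp
  refine ⟨LinearMap.snd R Y M ∘ₗ G.subtype ∘ₗ e.symm.toLinearMap, ?_⟩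
  ext x
  have : e.symm (i x) = ⟨(i x, f x), le_gvClosure _ ⟨x, rfl⟩⟩ := by
    rw [LinearEquiv.symm_apply_eq]; rfl
  simp [this]

theorem isGVTorsionFree_finsupp (ι : Type*) : IsGVTorsionFree R (ι →₀ R) := by
  rw [isGVTorsionFree_iff]
  intro J hJ x hx
  ext i
  refine hJ.eq_zero fun a ha => ?_
  rw [mul_comm]
  exact DFunLike.congr_fun (hx a ha) i

/-- Each coordinate of `φ` is multiplication by a scalar `c i`. If every generator of `J` has zero
`i`-th coordinate under `φ`, then `c i` kills `J` and vanishes; so finite generation of `J` makes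
`c` finitely supported. -/
theorem hasGVExtension_finsupp (ι : Type*) : HasGVExtension R (ι →₀ R) := by
  classical
  intro J hJ φ
  choose c hc using fun i => hJ.exists_mul (Finsupp.lapply i ∘ₗ φ)
  obtain ⟨n, d, hd⟩ := hJ.exists_generators
  have hdJ : ∀ k, d k ∈ J := fun k => hd ▸ Ideal.subset_span ⟨k, rfl⟩
  let s : Finset ι := Finset.univ.biUnion fun k => (φ ⟨d k, hdJ k⟩).support
  have hs : ∀ i, c i ≠ 0 → i ∈ s := by
    intro i hi
    by_contra his
    refine hi (hJ.eq_zero fun a ha => ?_)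
    rw [← hd] at ha
    refine smul_mem_of_mem_span_range (S := (⊥ : Submodule R R)) (x := c i) (fun k => ?_) a ha
      |> fun h => by rw [mul_comm]; exact h
    have h₁ := hc i ⟨d k, hdJ k⟩
    have h₂ : φ ⟨d k, hdJ k⟩ i = 0 := by
      by_contra h
      exact his (Finset.mem_biUnion.2 ⟨k, Finset.mem_univ k, Finsupp.mem_support_iff.2 h⟩)
    rw [Submodule.mem_bot, smul_eq_mul, mul_comm, ← h₁]
    exact h₂
  refine ⟨Finsupp.onFinset s c hs, fun a => ?_⟩
  ext i
  simpa [mul_comm] using hc i a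

theorem isGVTorsionFree_of_projective [Module.Projective R M] : IsGVTorsionFree R M := by
  obtain ⟨s, hs⟩ := Module.projective_def'.1 (inferInstance : Module.Projective R M)
  exact (isGVTorsionFree_finsupp M).of_injective s
    (Function.LeftInverse.injective (g := Finsupp.linearCombination R id) (LinearMap.congr_fun hs))

theorem hasGVExtension_of_projective [Module.Projective R M] : HasGVExtension R M := by
  obtain ⟨s, hs⟩ := Module.projective_def'.1 (inferInstance : Module.Projective R M)
  intro J hJ φ
  obtain ⟨m, hm⟩ := hasGVExtension_finsupp M J hJ (s ∘ₗ φ)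
  refine ⟨Finsupp.linearCombination R id m, fun a => ?_⟩
  rw [← map_smul, ← hm]
  exact (LinearMap.congr_fun hs _).symm

/-- A GV-closed submodule inherits the extension property. -/
theorem HasGVExtension.of_gvClosure_le (h : HasGVExtension R M) {S : Submodule R M}
    (hS : gvClosure S ≤ S) : HasGVExtension R S := by
  intro J hJ φ
  obtain ⟨m, hm⟩ := h J hJ (S.subtype ∘ₗ φ)
  have hmS : m ∈ S := hS ⟨J, hJ, fun a ha => by rw [← hm ⟨a, ha⟩]; exact (φ ⟨a, ha⟩).2⟩
  exact ⟨⟨m, hmS⟩, fun a => Subtype.ext (hm a)⟩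

theorem gvClosure_ker_le (h : IsGVTorsionFree R N) (f : M →ₗ[R] N) :
    gvClosure (LinearMap.ker f) ≤ LinearMap.ker f := by
  rintro x ⟨J, hJ, hx⟩
  exact isGVTorsionFree_iff.1 h J hJ _ fun a ha => by rw [← map_smul]; exact hx a ha

/-- A submodule with the extension property is GV-closed in any GV-torsionfree module. -/
theorem HasGVExtension.gvClosure_range_le (hN : IsGVTorsionFree R N) (h : HasGVExtension R M)
    (j : M →ₗ[R] N) (hj : Function.Injective j) :
    gvClosure (LinearMap.range j) ≤ LinearMap.range j := by
  rintro x ⟨J, hJ, hx⟩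
  let e := LinearEquiv.ofInjective j hj
  let ψ : J →ₗ[R] LinearMap.range j :=
    LinearMap.codRestrict _ (LinearMap.toSpanSingleton R N x ∘ₗ J.subtype)
      fun a => by simpa using hx a a.2
  obtain ⟨m, hm⟩ := h J hJ (e.symm.toLinearMap ∘ₗ ψ)
  refine ⟨m, sub_eq_zero.1 (isGVTorsionFree_iff.1 hN J hJ _ fun a ha => ?_)⟩
  have h₁ : j (e.symm (ψ ⟨a, ha⟩)) = a • x := by
    rw [← LinearEquiv.ofInjective_apply (h := hj), e.apply_symm_apply]; rfl
  have h₂ : e.symm (ψ ⟨a, ha⟩) = a • m := hm ⟨a, ha⟩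
  rw [smul_sub, ← map_smul, ← h₂, h₁, sub_self]

/-- An essential extension of a GV-torsionfree module is GV-torsionfree. -/
theorem IsGVTorsionFree.of_essential (h : IsGVTorsionFree R M) (j : M →ₗ[R] N)
    (hj : Function.Injective j)
    (hess : ∀ S : Submodule R N, S ⊓ LinearMap.range j = ⊥ → S = ⊥) : IsGVTorsionFree R N := by
  refine hess _ (eq_bot_iff.2 ?_)
  rintro _ ⟨⟨J, hJ, hx⟩, m, rfl⟩
  rw [isGVTorsionFree_iff.1 h J hJ m fun a ha => hj ?_, map_zero]
  · exact zero_mem _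
  · rw [map_smul, map_zero]; exact hx a ha

end GVBasics

/-! ### The `Ext` condition for `w`-modules as an extension property. -/

section WModuleExt

variable {R : Type u} [CommRing R] {M : Type u} [AddCommGroup M] [Module R M]

/-- As `R` is projective, the long exact sequence of `0 → J → R → R/J → 0` presents `Ext¹(R/J, M)`
as the cokernel of `Hom(R, M) → Hom(J, M)`. -/
theorem isWModule_iff : IsWModule R M ↔ IsGVTorsionFree R M ∧ HasGVExtension R M := by
  refine and_congr_right fun h₀ => forall₂_congr fun J hJ => ?_
  let S := ModuleCat.shortComplexOfCompEqZero J.subtype J.mkQ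
    (by ext x; exact (Submodule.Quotient.mk_eq_zero J).2 x.2)
  have hS : S.ShortExact := ModuleCat.shortComplex_shortExact S
    (LinearMap.exact_subtype_mkQ J) J.injective_subtype J.mkQ_surjective
  constructor
  · intro hE φ
    obtain ⟨x, hx⟩ := Abelian.Ext.contravariant_sequence_exact₁ hS (ModuleCat.of R M)
      (Abelian.Ext.mk₀ (ModuleCat.ofHom φ)) (n₁ := 1) rfl (Subsingleton.elim (h := hE) _ _)
    obtain ⟨ψ, rfl⟩ := (Abelian.Ext.mk₀_bijective _ _).2 x
    rw [Abelian.Ext.mk₀_comp_mk₀] at hx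
    have := (Abelian.Ext.mk₀_bijective _ _).1 hx
    refine ⟨ψ.hom (1 : R), fun a => ?_⟩
    have h₁ : φ a = ψ.hom (a : R) := (LinearMap.congr_fun (congrArg ModuleCat.Hom.hom this) a).symm
    have h₂ : ψ.hom ((a : R) • (1 : R)) = (a : R) • ψ.hom (1 : R) := map_smul ψ.hom _ _
    rw [h₁, ← h₂]; simp
  · intro h
    refine subsingleton_of_forall_eq 0 fun e => ?_
    have : Projective S.X₂ := inferInstanceAs (Projective (ModuleCat.of R R))
    obtain ⟨x, rfl⟩ := Abelian.Ext.contravariant_sequence_exact₃ hS (ModuleCat.of R M) e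
      (Abelian.Ext.eq_zero_of_projective _) (n₀ := 0) rfl
    obtain ⟨φ, rfl⟩ := (Abelian.Ext.mk₀_bijective _ _).2 x
    obtain ⟨m, hm⟩ := h φ.hom
    have : φ = S.f ≫ ModuleCat.ofHom (LinearMap.toSpanSingleton R M m) := by
      ext a
      exact hm a
    rw [this, ← Abelian.Ext.mk₀_comp_mk₀, ShortComplex.ShortExact.extClass_comp_assoc]

end WModuleExt

/-! ### Existence of injective envelopes. -/

section InjectiveEnvelope

variable {R : Type u} [CommRing R] {M : Type u} [AddCommGroup M] [Module R M]

/-- Every module embeds into an injective module. -/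
theorem exists_injective_embedding (R : Type u) [CommRing R] (M : Type u) [AddCommGroup M]
    [Module R M] : ∃ (E : Type u) (_ : AddCommGroup E) (_ : Module R E) (j : M →ₗ[R] E),
      Module.Injective R E ∧ Function.Injective j := by
  let A : ModuleCat.{u} R := ModuleCat.of R M
  let B : ModuleCat.{u} R := Injective.under A
  refine ⟨B, inferInstance, inferInstance, (Injective.ι A).hom, ?_, ?_⟩
  · have : Injective (ModuleCat.of R B) := inferInstanceAs (Injective (Injective.under A))
    exact Module.injective_module_of_injective_object R _
  · exact (ModuleCat.mono_iff_injective _).1 inferInstance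

/-- Every element of `E` generates a submodule that is zero or meets `N`. -/
def IsEssentialOver (N E : Submodule R M) : Prop :=
  ∀ x ∈ E, Submodule.span R {x} ⊓ N = ⊥ → x = 0

theorem exists_maximal_essential (N : Submodule R M) :
    ∃ E, N ≤ E ∧ Maximal (fun E => IsEssentialOver N E) E := by
  refine zorn_le_nonempty₀ {E | IsEssentialOver N E} (fun c hc hchain y hy => ?_) N
    fun x hx h => ?_
  · refine ⟨sSup c, fun x hx => ?_, fun z hz => le_sSup hz⟩
    obtain ⟨E, hE, hxE⟩ := (Submodule.mem_sSup_of_directed ⟨y, hy⟩ hchain.directedOn).1 hx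
    exact hc hE x hxE
  · have : x ∈ Submodule.span R {x} ⊓ N := ⟨Submodule.mem_span_singleton_self x, hx⟩
    rwa [h, Submodule.mem_bot] at this

theorem exists_maximal_disjoint (E : Submodule R M) :
    ∃ C, Maximal (fun C => Disjoint E C) C := by
  obtain ⟨C, -, hC⟩ := zorn_le_nonempty₀ {C | Disjoint E C} (fun c hc hchain y hy =>
    ⟨sSup c, hchain.directedOn.disjoint_sSup_right.2 fun _ hb => hc hb,
      fun z hz => le_sSup hz⟩) ⊥ disjoint_bot_right
  exact ⟨C, hC⟩

/-- A maximal essential extension inside an injective module is a direct summand. -/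
theorem exists_retraction_of_maximal_essential [Module.Injective R M] {N E : Submodule R M}
    (hE : Maximal (fun E => IsEssentialOver N E) E) :
    ∃ r : M →ₗ[R] E, ∀ e : E, r e = e := by
  obtain ⟨C, hC⟩ := exists_maximal_disjoint E
  have hinj : Function.Injective (C.mkQ ∘ₗ E.subtype) := by
    rw [injective_iff_map_eq_zero]
    intro e he
    have h₁ : (e : M) ∈ C := (Submodule.Quotient.mk_eq_zero C).1 he
    exact Subtype.ext (Submodule.disjoint_def.1 hC.prop e e.2 h₁)
  obtain ⟨φ, hφ⟩ := Module.Injective.out (C.mkQ ∘ₗ E.subtype) hinj E.subtype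
  have hφE : ∀ e ∈ E, φ (C.mkQ e) = e := fun e he => hφ ⟨e, he⟩
  have hle : E ≤ LinearMap.range φ := fun e he => ⟨_, hφE e he⟩
  -- If `φ (C.mkQ z)` generates a submodule that misses `N`, the preimage `T` of that submodule
  -- contains `C` and still misses `E`. Maximality of `C` puts `z` in `C`. So the range of `φ` is
  -- essential over `N`, and maximality of `E` makes it equal to `E`.
  have hess : IsEssentialOver N (LinearMap.range φ) := by
    rintro _ ⟨x, rfl⟩ hx
    obtain ⟨z, rfl⟩ := C.mkQ_surjective x
    let T := (Submodule.span R {φ (C.mkQ z)}).comap (φ ∘ₗ C.mkQ)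
    have hCT : C ≤ T := fun c hc => by
      have : C.mkQ c = 0 := (Submodule.Quotient.mk_eq_zero C).2 hc
      simp only [T, Submodule.mem_comap, LinearMap.comp_apply, this, map_zero, zero_mem]
    have hT : Disjoint E T := by
      rw [Submodule.disjoint_def]
      intro e he heT
      have h₁ : e ∈ Submodule.span R {φ (C.mkQ z)} := by rw [← hφE e he]; exact heT
      refine hE.prop e he (eq_bot_iff.2 ?_)
      rw [← hx]
      exact inf_le_inf_right _ ((Submodule.span_singleton_le_iff_mem _ _).2 h₁)
    have hz : z ∈ C := hC.le_of_ge hT hCT (Submodule.mem_span_singleton_self _)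
    rw [show C.mkQ z = 0 from (Submodule.Quotient.mk_eq_zero C).2 hz, map_zero]
  have hr : LinearMap.range φ ≤ E := hE.le_of_ge hess hle
  exact ⟨LinearMap.codRestrict E (φ ∘ₗ C.mkQ) fun z => hr ⟨_, rfl⟩,
    fun e => Subtype.ext (hφE e e.2)⟩

/-- The envelope is a maximal essential extension inside an injective module; being a retract of
that module, it is injective. -/
theorem exists_injectiveEnvelope (R : Type u) [CommRing R] (M : Type u) [AddCommGroup M]
    [Module R M] : ∃ (E : Type u) (_ : AddCommGroup E) (_ : Module R E) (j : M →ₗ[R] E),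
      IsInjectiveEnvelope j := by
  obtain ⟨I, _, _, i, hI, hi⟩ := exists_injective_embedding R M
  obtain ⟨E, hNE, hE⟩ := exists_maximal_essential (LinearMap.range i)
  obtain ⟨r, hr⟩ := exists_retraction_of_maximal_essential hE
  refine ⟨E, inferInstance, inferInstance,
    LinearMap.codRestrict E i fun m => hNE ⟨m, rfl⟩, ⟨fun X Y _ _ _ _ f hf g => ?_⟩,
    fun x y h => hi (congrArg Subtype.val h), fun S hS => ?_⟩
  · obtain ⟨k, hk⟩ := Module.Injective.out f hf (E.subtype ∘ₗ g)
    exact ⟨r ∘ₗ k, fun x => by rw [LinearMap.comp_apply, hk]; exact hr _⟩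
  · rw [eq_bot_iff]
    intro s hs
    refine Subtype.ext (hE.prop s s.2 (eq_bot_iff.2 ?_))
    rintro _ ⟨h₁, m, rfl⟩
    obtain ⟨a, ha⟩ := Submodule.mem_span_singleton.1 h₁
    have h₂ : a • s ∈ S ⊓ LinearMap.range (LinearMap.codRestrict E i fun m => hNE ⟨m, rfl⟩) :=
      ⟨S.smul_mem a hs, m, Subtype.ext ha.symm⟩
    rw [hS, Submodule.mem_bot] at h₂
    rw [← ha]
    exact congrArg Subtype.val h₂

end InjectiveEnvelope

/-! ### `w`-projectivity and factorization through projective modules. -/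

section WProjective

variable {R : Type u} [CommRing R]

/-- The elements of some generating family of a GV-ideal act on `X` through a projective
module. -/
def HasWSplitting (R : Type u) [CommRing R] (X : Type u) [AddCommGroup X] [Module R X] : Prop :=
  ∃ (P : Type u) (_ : AddCommGroup P) (_ : Module R P) (g : P →ₗ[R] X) (n : ℕ) (d : Fin n → R)
    (h : Fin n → X →ₗ[R] P), Module.Projective R P ∧ IsWSplitting g d h

/-- Multiplication by `d` on `Ext¹(X, N)` factors through `Ext¹(P, N) = 0`. -/
theorem ext_smul_eq_zero_of_factors {P X N : Type u} [AddCommGroup P] [Module R P]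
    [AddCommGroup X] [Module R X] [AddCommGroup N] [Module R N] [Module.Projective R P]
    (g : P →ₗ[R] X) (h : X →ₗ[R] P) {d : R} (hgh : g ∘ₗ h = d • LinearMap.id)
    (e : Abelian.Ext (ModuleCat.of R X) (ModuleCat.of R N) 1) : d • e = 0 := by
  have h₁ : ModuleCat.ofHom h ≫ ModuleCat.ofHom g = d • 𝟙 (ModuleCat.of R X) := by
    ext x
    exact LinearMap.congr_fun hgh x
  have h₂ : (Abelian.Ext.mk₀ (ModuleCat.ofHom h ≫ ModuleCat.ofHom g)).comp e (zero_add 1) = 0 := by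
    rw [← Abelian.Ext.mk₀_comp_mk₀_assoc,
      Abelian.Ext.eq_zero_of_projective ((Abelian.Ext.mk₀ (ModuleCat.ofHom g)).comp e _),
      Abelian.Ext.comp_zero]
  rw [← h₂, h₁, Abelian.Ext.mk₀_smul, Abelian.Ext.smul_comp, Abelian.Ext.mk₀_id_comp]

theorem HasWSplitting.isGVTorsion_ext {X : Type u} [AddCommGroup X] [Module R X]
    (hX : HasWSplitting R X) (N : Type u) [AddCommGroup N] [Module R N] :
    IsGVTorsion R (Abelian.Ext (ModuleCat.of R X) (ModuleCat.of R N) 1) := by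
  obtain ⟨P, _, _, g, n, d, h, hP, hd, hgh⟩ := hX
  refine eq_top_iff.2 fun e _ => ⟨_, hd, smul_mem_of_mem_span_range fun k => ?_⟩
  exact ext_smul_eq_zero_of_factors g (h k) (hgh k) e

/-- A splitting through a projective module passes to GV-torsionfree extensions with GV-torsion
cokernel. -/
theorem HasWSplitting.of_extension {X Y : Type u} [AddCommGroup X] [Module R X] [AddCommGroup Y]
    [Module R Y] (hX : HasWSplitting R X) (hY : IsGVTorsionFree R Y) (i : X →ₗ[R] Y)
    (hi : Function.Injective i) (hiY : gvClosure (LinearMap.range i) = ⊤) :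
    HasWSplitting R Y := by
  obtain ⟨P, _, _, g, n, d, h, hP, hd, hgh⟩ := hX
  choose h' hh' using fun k => hasGVExtension_of_projective.exists_extension
    isGVTorsionFree_of_projective i hi hiY (h k)
  refine ⟨P, _, _, i ∘ₗ g, n, d, h', hP, hd, fun k => ?_⟩
  ext y
  obtain ⟨J, hJ, hy⟩ : y ∈ gvClosure (LinearMap.range i) := hiY ▸ trivial
  -- The identity holds on `X`, and `J` carries `y` into `X`; since `Y` is GV-torsionfree, it can be
  -- checked after multiplication by `J`.
  refine sub_eq_zero.1 (isGVTorsionFree_iff.1 hY J hJ _ fun a ha => ?_)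
  obtain ⟨x, hx⟩ := hy a ha
  have h₁ : h' k (i x) = h k x := LinearMap.congr_fun (hh' k) x
  have h₂ : g (h k x) = d k • x := LinearMap.congr_fun (hgh k) x
  rw [smul_sub, sub_eq_zero, LinearMap.comp_apply, LinearMap.comp_apply, ← map_smul, ← map_smul,
    ← map_smul, ← hx, h₁, h₂, map_smul, LinearMap.smul_apply, LinearMap.id_apply, smul_comm, hx]

/-- The embedding of `X` into `L(X)` has GV-torsion cokernel, so the splitting passes to `L(X)`,
where it makes `Ext¹` GV-torsion. -/
theorem HasWSplitting.isWProjective {X : Type u} [AddCommGroup X] [Module R X]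
    (hX : HasWSplitting R X) (hX₀ : IsGVTorsionFree R X) : IsWProjective R X := by
  obtain ⟨E, _, _, j, hj⟩ := exists_injectiveEnvelope R (X ⧸ torGV R X)
  refine ⟨E, _, _, j, hj, fun N _ _ _ _ => HasWSplitting.isGVTorsion_ext ?_ N⟩
  let q : X ≃ₗ[R] X ⧸ torGV R X := (Submodule.quotEquivOfEqBot _ hX₀).symm
  have hE : IsGVTorsionFree R E :=
    (hX₀.of_injective q.symm.toLinearMap q.symm.injective).of_essential j hj.2.1 hj.2.2
  let i : X →ₗ[R] wEnvelope j :=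
    LinearMap.codRestrict _ (j ∘ₗ q.toLinearMap) fun x => le_gvClosure _ ⟨q x, rfl⟩
  refine hX.of_extension (hE.of_injective _ (wEnvelope j).injective_subtype) i
    (fun x y h => q.injective (hj.2.1 (congrArg Subtype.val h))) (eq_top_iff.2 ?_)
  rintro ⟨y, J, hJ, hy⟩ -
  refine ⟨J, hJ, fun a ha => ?_⟩
  obtain ⟨z, hz⟩ := hy a ha
  exact ⟨q.symm z, Subtype.ext ((congrArg j (q.apply_symm_apply z)).trans hz)⟩

theorem isWModule_of_projective {P : Type u} [AddCommGroup P] [Module R P]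
    [Module.Projective R P] : IsWModule R P :=
  isWModule_iff.2 ⟨isGVTorsionFree_of_projective, hasGVExtension_of_projective⟩

theorem IsWModule.of_gvClosure_le {M : Type u} [AddCommGroup M] [Module R M]
    (hM : IsWModule R M) {S : Submodule R M} (hS : gvClosure S ≤ S) : IsWModule R S := by
  rw [isWModule_iff] at hM ⊢
  exact ⟨hM.1.of_injective _ S.injective_subtype, hM.2.of_gvClosure_le hS⟩

/-- An epimorphism from a free module onto a `w`-projective `w`-module is `w`-split. -/
theorem IsWProjective.exists_isWSplitting {M F : Type u} [AddCommGroup M] [Module R M]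
    [AddCommGroup F] [Module R F] (hproj : IsWProjective R M) (hw : IsWModule R M)
    [Module.Projective R F] [Module.IsTorsionFree R F] (g : F →ₗ[R] M)
    (hg : Function.Surjective g) :
    ∃ (n : ℕ) (d : Fin n → R) (h : Fin n → M →ₗ[R] F), IsWSplitting g d h := by
  obtain ⟨E, _, _, j, hj, hE⟩ := hproj
  obtain ⟨hM₀, hM₁⟩ := isWModule_iff.1 hw
  let q : M ≃ₗ[R] M ⧸ torGV R M := (Submodule.quotEquivOfEqBot _ hM₀).symm
  have hE₀ : IsGVTorsionFree R E :=
    (hM₀.of_injective q.symm.toLinearMap q.symm.injective).of_essential j hj.2.1 hj.2.2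
  have hj' : Function.Injective (j ∘ₗ q.toLinearMap) := hj.2.1.comp q.injective
  let i : M →ₗ[R] wEnvelope j :=
    LinearMap.codRestrict _ (j ∘ₗ q.toLinearMap) fun x => le_gvClosure _ ⟨q x, rfl⟩
  -- Here `L(M) = M`: a `w`-module is GV-closed in its injective envelope.
  have hi : Function.Bijective i := by
    refine ⟨fun x y h => hj' (congrArg Subtype.val h), fun ⟨y, hy⟩ => ?_⟩
    have hr : LinearMap.range (j ∘ₗ q.toLinearMap) = LinearMap.range j :=
      LinearMap.range_comp_of_range_eq_top _ (LinearMap.range_eq_top.2 q.surjective)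
    obtain ⟨x, hx⟩ := hM₁.gvClosure_range_le hE₀ _ hj' (show y ∈ _ by rw [hr]; exact hy)
    exact ⟨x, Subtype.ext hx⟩
  let e := LinearEquiv.ofBijective i hi
  have hS := LinearMap.shortExact_shortComplexKer hg
  have hP : IsWModule R (LinearMap.ker g) :=
    isWModule_of_projective.of_gvClosure_le (gvClosure_ker_le hM₀ g)
  obtain ⟨J, hJ, hJe⟩ : (Abelian.Ext.mk₀ (ModuleCat.ofHom e.symm.toLinearMap)).comp hS.extClass
      (zero_add 1) ∈ torGV R (Abelian.Ext (ModuleCat.of R (wEnvelope j))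
        (ModuleCat.of R (LinearMap.ker g)) 1) := by
    rw [show torGV R _ = ⊤ from hE (LinearMap.ker g) inferInstance hP]
    trivial
  obtain ⟨n, d, rfl⟩ := hJ.exists_generators
  have key : ∀ k, ∃ ψ : wEnvelope j →ₗ[R] F, g ∘ₗ ψ = d k • e.symm.toLinearMap := by
    intro k
    -- The extension class pulled back along `d k • e⁻¹` vanishes, which is the obstruction to
    -- lifting this map through `g`.
    have h₁ := hJe (d k) (Ideal.subset_span ⟨k, rfl⟩)
    rw [Submodule.mem_bot, ← Abelian.Ext.smul_comp, ← Abelian.Ext.mk₀_smul] at h₁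
    obtain ⟨x, hx⟩ := Abelian.Ext.covariant_sequence_exact₃ _ hS _ _ h₁
    obtain ⟨ψ, rfl⟩ := (Abelian.Ext.mk₀_bijective _ _).2 x
    rw [Abelian.Ext.mk₀_comp_mk₀] at hx
    have h₂ := (Abelian.Ext.mk₀_bijective _ _).1 hx
    exact ⟨ψ.hom, congrArg ModuleCat.Hom.hom h₂⟩
  choose ψ hψ using key
  refine ⟨n, d, fun k => ψ k ∘ₗ e.toLinearMap, hJ, fun k => ?_⟩
  ext x
  have := LinearMap.congr_fun (hψ k) (e x)
  simpa using this

theorem IsWProjective.nonempty_wSplitPresentation {M : Type u} [AddCommGroup M] [Module R M]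
    (hproj : IsWProjective R M) (hw : IsWModule R M) : Nonempty (WSplitPresentation R M) := by
  let g : (M →₀ R) →ₗ[R] M := Finsupp.linearCombination R id
  have hg : Function.Surjective g := Finsupp.linearCombination_id_surjective R M
  obtain ⟨n, d, h, hs⟩ := hproj.exists_isWSplitting hw g hg
  let e : ∀ i : M, R ≃ₗ[R] LinearMap.range (Finsupp.lsingle i : R →ₗ[R] M →₀ R) := fun i =>
    LinearEquiv.ofInjective _ (Finsupp.single_injective i)
  exact ⟨{
    P := LinearMap.ker g
    F := M →₀ R
    f := (LinearMap.ker g).subtype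
    g := g
    f_injective := Subtype.val_injective
    exact := LinearMap.exact_subtype_ker_map g
    g_surjective := hg
    n := n
    d := d
    h := h
    splitting := hs
    I := M
    component := fun i => LinearMap.range (Finsupp.lsingle i)
    independent := iSupIndep_range_lsingle M R R
    iSup_component := Finsupp.iSup_lsingle_range
    projective := fun i => Module.Projective.of_equiv (e i)
    countablyGenerated := fun i => ⟨{e i 1}, Set.countable_singleton _, by
      rw [← Set.image_singleton, ← LinearEquiv.coe_coe, Submodule.span_image,
        show Submodule.span R {(1 : R)} = ⊤ from Ideal.span_singleton_one, Submodule.map_top]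
      exact (e i).range⟩ }⟩

end WProjective

/-! ### Countable generation and countable closures. -/

section CountablyGenerated

variable {R : Type u} [CommRing R] {M N : Type*} [AddCommGroup M] [Module R M]
  [AddCommGroup N] [Module R N]

theorem IsCountablyGenerated.of_surjective (h : IsCountablyGenerated R M) (f : M →ₗ[R] N)
    (hf : Function.Surjective f) : IsCountablyGenerated R N := by
  obtain ⟨s, hs, hs'⟩ := h
  refine ⟨f '' s, hs.image f, ?_⟩
  rw [Submodule.span_image, hs', Submodule.map_top, LinearMap.range_eq_top.2 hf]

theorem isCountablyGenerated_submodule_iff {S : Submodule R M} :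
    IsCountablyGenerated R S ↔ ∃ t : Set M, t.Countable ∧ Submodule.span R t = S := by
  constructor
  · rintro ⟨s, hs, hs'⟩
    refine ⟨S.subtype '' s, hs.image _, ?_⟩
    rw [Submodule.span_image, hs', Submodule.map_top, Submodule.range_subtype]
  · rintro ⟨t, ht, rfl⟩
    exact ⟨Subtype.val ⁻¹' t, ht.preimage Subtype.val_injective, Submodule.span_span_coe_preimage⟩

theorem isCountablyGenerated_biSup {ι : Type*} {S : ι → Submodule R M} {C : Set ι}
    (hC : C.Countable) (h : ∀ i, IsCountablyGenerated R (S i)) :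
    IsCountablyGenerated R (⨆ i ∈ C, S i : Submodule R M) := by
  choose t ht htS using fun i => isCountablyGenerated_submodule_iff.1 (h i)
  refine isCountablyGenerated_submodule_iff.2 ⟨⋃ i ∈ C, t i, hC.biUnion fun i _ => ht i, ?_⟩
  simp_rw [Submodule.span_iUnion, htS]

/-- A countably generated submodule of a sum lies in a countable partial sum. -/
theorem exists_countable_le_biSup {ι : Type*} {S : ι → Submodule R M} (hS : ⨆ i, S i = ⊤)
    {T : Submodule R M} (hT : IsCountablyGenerated R T) :
    ∃ C : Set ι, C.Countable ∧ T ≤ ⨆ i ∈ C, S i := by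
  obtain ⟨t, ht, rfl⟩ := isCountablyGenerated_submodule_iff.1 hT
  choose c hc using fun x : M =>
    Submodule.exists_finset_of_mem_iSup S (show x ∈ ⨆ i, S i by rw [hS]; trivial)
  refine ⟨⋃ x ∈ t, (c x : Set ι), ht.biUnion fun x _ => (c x).countable_toSet, ?_⟩
  rw [Submodule.span_le]
  intro x hx
  have : (⨆ i ∈ c x, S i) ≤ ⨆ i ∈ ⋃ x ∈ t, (c x : Set ι), S i :=
    biSup_mono fun i hi => Set.mem_biUnion hx hi
  exact this (hc x)

/-- Every point lies in a countable set closed under a countable-valued relation. -/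
theorem exists_countable_closed {ι : Type*} {s : ι → Set ι} (hs : ∀ i, (s i).Countable) (i : ι) :
    ∃ C : Set ι, C.Countable ∧ i ∈ C ∧ ∀ j ∈ C, s j ⊆ C := by
  let T : ℕ → Set ι := fun n => Nat.rec {i} (fun _ U => ⋃ j ∈ U, s j) n
  have hT : ∀ n, (T n).Countable := fun n => by
    induction n with
    | zero => exact Set.countable_singleton i
    | succ n ih => exact ih.biUnion fun j _ => hs j
  refine ⟨⋃ n, T n, Set.countable_iUnion hT, Set.mem_iUnion.2 ⟨0, rfl⟩, fun j hj => ?_⟩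
  obtain ⟨n, hn⟩ := Set.mem_iUnion.1 hj
  exact fun k hk => Set.mem_iUnion.2 ⟨n + 1, Set.mem_biUnion hn hk⟩

end CountablyGenerated

/-! ### Localization at maximal `w`-ideals. -/

section Localization

variable {R : Type u} [CommRing R]

/-- If `J ≤ m`, the extension property of the `w`-module `m` makes the inclusion multiplication by
some `c ∈ m`. Then `1 - c` kills `J`, so `c = 1`. -/
theorem IsMaximalWIdeal.not_le {m : Ideal R} (hm : IsMaximalWIdeal m) {J : Ideal R}
    (hJ : IsGVIdeal J) : ¬ J ≤ m := by
  intro hJm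
  obtain ⟨c, hc⟩ := (isWModule_iff.1 hm.prop.2).2 J hJ (Submodule.inclusion hJm)
  refine hm.prop.1 ((Ideal.eq_top_iff_one m).2 ?_)
  have : 1 - (c : R) = 0 := hJ.eq_zero fun a ha => by
    have h : a = a * c := congrArg Subtype.val (hc ⟨a, ha⟩)
    rw [sub_mul, one_mul, mul_comm, ← h, sub_self]
  rw [sub_eq_zero.1 this]
  exact c.2

/-- The inclusion of a submodule with GV-torsion quotient is a `w`-isomorphism. -/
theorem isWIsomorphism_subtype {X : Type u} [AddCommGroup X] [Module R X] {S : Submodule R X}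
    (hS : gvClosure S = ⊤) : IsWIsomorphism S.subtype := by
  intro m _ hm
  refine ⟨LocalizedModule.map_injective _ _ S.injective_subtype, fun y => ?_⟩
  induction y using LocalizedModule.induction_on with
  | h x t =>
    obtain ⟨J, hJ, hx⟩ : x ∈ gvClosure S := hS ▸ trivial
    -- An element `a` of `J` outside `m` turns `x/t` into `ax/(at)`, whose numerator lies in `S`.
    obtain ⟨a, haJ, ham⟩ := Set.not_subset.1 (hm.not_le hJ)
    refine ⟨LocalizedModule.mk ⟨a • x, hx a haJ⟩ ((⟨a, ham⟩ : m.primeCompl) * t), ?_⟩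
    rw [LocalizedModule.map_mk]
    exact LocalizedModule.mk_cancel_common_left (⟨a, ham⟩ : m.primeCompl) t x

end Localization

/-! ### Submodules induced by a presentation, and their quotients. -/

namespace WSplitPresentation

variable {R : Type u} [CommRing R] {M : Type u} [AddCommGroup M] [Module R M]
  (ξ : WSplitPresentation R M)

theorem subF_mono {H H' : Set ξ.I} (h : H ⊆ H') : ξ.subF H ≤ ξ.subF H' :=
  biSup_mono fun _ hi => h hi

theorem subM_mono {H H' : Set ξ.I} (h : H ⊆ H') : ξ.subM H ≤ ξ.subM H' :=
  Submodule.map_mono (ξ.subF_mono h)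

theorem subF_union (H H' : Set ξ.I) : ξ.subF (H ∪ H') = ξ.subF H ⊔ ξ.subF H' := iSup_union

theorem subF_univ : ξ.subF Set.univ = ⊤ := by
  rw [subF, iSup_univ, ξ.iSup_component]

theorem subM_univ : ξ.subM Set.univ = ⊤ := by
  rw [subM, subF_univ, Submodule.map_top, LinearMap.range_eq_top.2 ξ.g_surjective]

theorem subM_empty : ξ.subM ∅ = ⊥ := by
  simp [subM, subF]

theorem isCompl_subF (H : Set ξ.I) : IsCompl (ξ.subF H) (ξ.subF Hᶜ) :=
  ⟨ξ.independent.disjoint_biSup_biSup disjoint_compl_right, codisjoint_iff.2 (by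
    rw [← subF_union, Set.union_compl_self, subF_univ])⟩

theorem projective_F : Module.Projective R ξ.F := by
  classical
  have := ξ.projective
  exact Module.Projective.of_equiv (LinearEquiv.ofBijective
    (DirectSum.coeLinearMap ξ.component)
    (DirectSum.isInternal_submodule_of_iSupIndep_of_iSup_eq_top ξ.independent ξ.iSup_component))

instance projective_subF (H : Set ξ.I) : Module.Projective R (ξ.subF H) :=
  have := ξ.projective_F
  Module.Projective.of_split (ξ.subF H).subtype (Submodule.projectionOnto _ _ (ξ.isCompl_subF H))
    (LinearMap.ext fun x => Submodule.projectionOnto_apply_left (ξ.isCompl_subF H) x)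

/-- `F(H)` is the kernel of the projection onto the complementary summand, which is projective and
hence GV-torsionfree. -/
theorem gvClosure_subF_le (H : Set ξ.I) : gvClosure (ξ.subF H) ≤ ξ.subF H := by
  have := gvClosure_ker_le isGVTorsionFree_of_projective
    (Submodule.projectionOnto _ _ (ξ.isCompl_subF H).symm)
  rwa [Submodule.ker_projectionOnto] at this

theorem isCountablyGenerated_subF {C : Set ξ.I} (hC : C.Countable) :
    IsCountablyGenerated R (ξ.subF C) :=
  isCountablyGenerated_biSup hC ξ.countablyGenerated

theorem IsInduced.le_comap_gvClosure {ξ : WSplitPresentation R M} {H : Set ξ.I}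
    (hH : ξ.IsInduced H) (k : Fin ξ.n) :
    gvClosure (ξ.subM H) ≤ (ξ.subF H).comap (ξ.h k) := by
  rintro x ⟨J, hJ, hx⟩
  exact ξ.gvClosure_subF_le H ⟨J, hJ, fun a ha => by
    rw [← map_smul]; exact hH k (hx a ha)⟩

theorem IsInduced.hasWSplitting_gvClosure {ξ : WSplitPresentation R M} {H : Set ξ.I}
    (hH : ξ.IsInduced H) : HasWSplitting R (gvClosure (ξ.subM H)) :=
  ⟨ξ.subF H, inferInstance, inferInstance,
    ξ.g.restrict fun _ hy => le_gvClosure _ (Submodule.mem_map_of_mem hy), ξ.n, ξ.d,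
    fun k => (ξ.h k).restrict fun _ hx => hH.le_comap_gvClosure k hx, inferInstance,
    ξ.splitting.1, fun k => LinearMap.ext fun x =>
      Subtype.ext (LinearMap.congr_fun (ξ.splitting.2 k) x)⟩

/-- The maps `h_k` and `g` induce maps between `B / A` and `F(H' \ H) ≅ F(H') / F(H)` as soon as
they respect `A` and `F(H)`, and `B` and `F(H')`. -/
theorem exists_quotient_splitting {H H' : Set ξ.I} (hH : H ⊆ H') {A B : Submodule R M}
    (hA : ξ.subM H ≤ A) (hB : ξ.subM H' ≤ B)
    (hhA : ∀ k, A ≤ (ξ.subF H).comap (ξ.h k)) (hhB : ∀ k, B ≤ (ξ.subF H').comap (ξ.h k)) :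
    ∃ (g' : ξ.subF (H' \ H) →ₗ[R] B ⧸ A.submoduleOf B)
      (h' : Fin ξ.n → (B ⧸ A.submoduleOf B) →ₗ[R] ξ.subF (H' \ H)),
      IsWSplitting g' ξ.d h' ∧
        ∀ (x : B), (x : M) ∈ ξ.subM H' → Submodule.Quotient.mk x ∈ LinearMap.range g' := by
  let p : ξ.F →ₗ[R] ξ.subF (H' \ H) := Submodule.projectionOnto _ _ (ξ.isCompl_subF (H' \ H))
  have hgB : ∀ y ∈ ξ.subF H', ξ.g y ∈ B := fun y hy => hB (Submodule.mem_map_of_mem hy)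
  have hHC : H ⊆ (H' \ H)ᶜ := fun i hi h => h.2 hi
  have hpH : ∀ y ∈ ξ.subF H, p y = 0 := fun y hy =>
    Submodule.projectionOnto_apply_of_mem_right _ (ξ.subF_mono hHC hy)
  -- On `F(H')` the projection `p` only discards the `F(H)` part, whose image under `g` lies in `A`;
  -- hence `g' (p y)` is the class of `g y`.
  have hp : ∀ y ∈ ξ.subF H', y - p y ∈ ξ.subF H := by
    intro y hy
    rw [← Set.sdiff_union_of_subset hH, subF_union] at hy
    obtain ⟨c, hc, b, hb, rfl⟩ := Submodule.mem_sup.1 hy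
    have hpc : (p c : ξ.F) = c :=
      congrArg Subtype.val (Submodule.projectionOnto_apply_of_mem_left _ hc)
    rw [map_add, hpH b hb, add_zero, hpc, add_sub_cancel_left]
    exact hb
  let g' : ξ.subF (H' \ H) →ₗ[R] B ⧸ A.submoduleOf B :=
    (A.submoduleOf B).mkQ ∘ₗ
      ξ.g.restrict fun y hy => hgB y (ξ.subF_mono Set.sdiff_subset hy)
  have hg' : ∀ (y : ξ.F) (hy : y ∈ ξ.subF H'),
      g' (p y) = Submodule.Quotient.mk ⟨ξ.g y, hgB y hy⟩ := by
    intro y hy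
    refine ((Submodule.Quotient.eq _).2 ?_).symm
    have : ξ.g (y - p y) ∈ A := hA (Submodule.mem_map_of_mem (hp y hy))
    rwa [map_sub] at this
  refine ⟨g', fun k => (A.submoduleOf B).liftQ (p ∘ₗ ξ.h k ∘ₗ B.subtype)
    fun x hx => hpH _ (hhA k hx), ⟨ξ.splitting.1, fun k => ?_⟩, ?_⟩
  · refine LinearMap.ext fun x => ?_
    obtain ⟨x, rfl⟩ := Submodule.Quotient.mk_surjective _ x
    refine (hg' (ξ.h k x) (hhB k x.2)).trans ?_
    exact congrArg Submodule.Quotient.mk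
      (Subtype.ext (LinearMap.congr_fun (ξ.splitting.2 k) (x : M)))
  · rintro ⟨_, hx⟩ ⟨y, hy, rfl⟩
    exact ⟨p y, hg' y hy⟩

theorem IsInduced.quotient_isCountablyGenerated_isWSplit {ξ : WSplitPresentation R M}
    {H H' : Set ξ.I} (hH : ξ.IsInduced H) (hH' : ξ.IsInduced H') (hle : H ⊆ H')
    (hc : (H' \ H).Countable) :
    IsCountablyGenerated R (ξ.subM H' ⧸ (ξ.subM H).submoduleOf (ξ.subM H')) ∧
      IsWSplit R (ξ.subM H' ⧸ (ξ.subM H).submoduleOf (ξ.subM H')) := by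
  obtain ⟨g', h', hs, hg'⟩ := ξ.exists_quotient_splitting hle le_rfl le_rfl hH hH'
  have hsurj : Function.Surjective g' := fun x => by
    obtain ⟨x, rfl⟩ := Submodule.Quotient.mk_surjective _ x
    exact hg' x x.2
  exact ⟨(ξ.isCountablyGenerated_subF hc).of_surjective g' hsurj,
    LinearMap.ker g', inferInstance, inferInstance, _, inferInstance, inferInstance,
    (LinearMap.ker g').subtype, g', inferInstance, Subtype.val_injective,
    LinearMap.exact_subtype_ker_map g', hsurj, ξ.n, ξ.d, h', hs⟩

/-- The map `g'` need not be onto, but `d k • x = g' (h' k x)`, so its countably generated range has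
GV-torsion cokernel. The quotient by a GV-closed submodule is GV-torsionfree, so the splitting gives
`w`-projectivity. -/
theorem IsInduced.quotient_gvClosure {ξ : WSplitPresentation R M}
    {H H' : Set ξ.I} (hH : ξ.IsInduced H) (hH' : ξ.IsInduced H') (hle : H ⊆ H')
    (hc : (H' \ H).Countable) :
    IsWCountablyGenerated R (gvClosure (ξ.subM H') ⧸
        (gvClosure (ξ.subM H)).submoduleOf (gvClosure (ξ.subM H'))) ∧
      IsWProjective R (gvClosure (ξ.subM H') ⧸
        (gvClosure (ξ.subM H)).submoduleOf (gvClosure (ξ.subM H'))) := by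
  obtain ⟨g', h', hs, -⟩ := ξ.exists_quotient_splitting hle (le_gvClosure _) (le_gvClosure _)
    hH.le_comap_gvClosure hH'.le_comap_gvClosure
  constructor
  · refine ⟨LinearMap.range g', inferInstance, inferInstance, (LinearMap.range g').subtype,
      (ξ.isCountablyGenerated_subF hc).of_surjective g'.rangeRestrict g'.surjective_rangeRestrict,
      isWIsomorphism_subtype (eq_top_iff.2 fun x _ =>
        ⟨_, hs.1, smul_mem_of_mem_span_range fun k => ⟨h' k x, LinearMap.congr_fun (hs.2 k) x⟩⟩)⟩
  · refine HasWSplitting.isWProjective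
      ⟨_, _, _, g', ξ.n, ξ.d, h', ξ.projective_subF _, hs⟩ (isGVTorsionFree_quotient ?_)
    rintro x ⟨J, hJ, hx⟩
    exact (gvClosure_idem _).le ⟨J, hJ, fun a ha => hx a ha⟩

/-- A family of induced index sets with countable steps exhausting the index set. -/
theorem exists_filtration : ∃ (α : Ordinal.{u}) (Hs : Ordinal.{u} → Set ξ.I),
    Monotone Hs ∧ Hs 0 = ∅ ∧ Hs α = Set.univ ∧
    (∀ l, Order.IsSuccLimit l → Hs l = ⋃ μ : Set.Iio l, Hs μ) ∧
    (∀ l, ξ.IsInduced (Hs l)) ∧ ∀ l < α, (Hs (l + 1) \ Hs l).Countable := by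
  -- The countable set of components met by all `hₖ(g(Fᵢ))`.
  have hN : ∀ i, ∃ C : Set ξ.I, C.Countable ∧
      ∀ k, ((ξ.component i).map ξ.g).map (ξ.h k) ≤ ξ.subF C := by
    intro i
    choose C hC hle using fun k => exists_countable_le_biSup ξ.iSup_component
      (isCountablyGenerated_submodule_iff.2 (by
        obtain ⟨t, ht, ht'⟩ := isCountablyGenerated_submodule_iff.1 (ξ.countablyGenerated i)
        exact ⟨ξ.h k '' (ξ.g '' t), (ht.image _).image _, by
          rw [Submodule.span_image, Submodule.span_image, ht']⟩) :
        IsCountablyGenerated R (((ξ.component i).map ξ.g).map (ξ.h k)))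
    exact ⟨⋃ k, C k, Set.countable_iUnion hC, fun k =>
      (hle k).trans (ξ.subF_mono (Set.subset_iUnion C k))⟩
  choose N hNc hN using hN
  choose cl hclc hcl hclN using exists_countable_closed hNc
  let r : ξ.I → ξ.I → Prop := WellOrderingRel
  -- The strict inequality makes `Hs 0` empty and `Hs` continuous at limits; a union of closed sets
  -- is closed, so each `Hs l` is induced.
  let Hs : Ordinal.{u} → Set ξ.I := fun l => {j | ∃ i, Ordinal.typein r i < l ∧ j ∈ cl i}
  refine ⟨Ordinal.type r, Hs, fun l m hlm j ⟨i, hi, hj⟩ => ⟨i, hi.trans_le hlm, hj⟩, ?_, ?_, ?_,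
    ?_, ?_⟩
  · exact Set.eq_empty_of_forall_notMem fun j ⟨i, hi, _⟩ => not_lt_bot hi
  · exact Set.eq_univ_of_forall fun j => ⟨j, Ordinal.typein_lt_type r j, hcl j⟩
  · intro l hl
    ext j
    simp only [Set.mem_iUnion]
    constructor
    · rintro ⟨i, hi, hj⟩
      exact ⟨⟨_, hl.succ_lt hi⟩, i, Order.lt_succ _, hj⟩
    · rintro ⟨m, i, hi, hj⟩
      exact ⟨i, hi.trans m.2, hj⟩
  · intro l k
    rw [subM, Submodule.map_le_iff_le_comap, subF, iSup₂_le_iff]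
    rintro j ⟨i, hi, hj⟩ y hy
    refine ξ.subF_mono (fun j' hj' => ?_) (hN j k
      (Submodule.mem_map_of_mem (Submodule.mem_map_of_mem hy)))
    exact ⟨i, hi, hclN i j hj hj'⟩
  · intro l hl
    obtain ⟨i, rfl⟩ := Ordinal.typein_surj r hl
    -- Passing from `l` to `l + 1` adds only members of `cl i`, for the single index `i` of rank
    -- `l`.
    refine (hclc i).mono ?_
    rintro j ⟨⟨i', hi', hj⟩, hj'⟩
    rcases (Order.lt_add_one_iff.1 hi').lt_or_eq with h | h
    · exact absurd ⟨i', h, hj⟩ hj'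
    · rwa [← Ordinal.typein_injective r h]

theorem mem_subM_iUnion {ι : Type*} [Nonempty ι] {H : ι → Set ξ.I} (hH : Directed (· ≤ ·) H)
    {x : M} (hx : x ∈ ξ.subM (⋃ i, H i)) : ∃ i, x ∈ ξ.subM (H i) := by
  obtain ⟨y, hy, rfl⟩ := hx
  rw [SetLike.mem_coe, subF, iSup_iUnion] at hy
  obtain ⟨i, hi⟩ := (Submodule.mem_iSup_of_directed _ (hH.mono_comp (g := ξ.subF) _
    fun _ _ h => ξ.subF_mono h)).1 hy
  exact ⟨i, Submodule.mem_map_of_mem hi⟩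

end WSplitPresentation

/-! ### The two filtrations. -/

section Main

variable {R : Type u} [CommRing R] {M : Type u} [AddCommGroup M] [Module R M]

theorem WSplitPresentation.isFilteredByCGWSplit_top (ξ : WSplitPresentation R M) :
    ξ.IsFilteredByCGWSplit ⊤ := by
  obtain ⟨α, Hs, hmono, h0, hα, hlim, hind, hcount⟩ := ξ.exists_filtration
  refine ⟨α, Set.univ, Hs, fun _ _ => Set.subset_univ _, h0, hα, ⟨?_, fun l _ => ?_, ?_⟩, ?_,
    fun l _ => hind l, fun l hl => ?_⟩
  · simp only [h0, ξ.subM_empty]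
  · exact ξ.subM_mono (hmono le_self_add)
  · intro l _ hl x
    refine ⟨fun hx => ?_, fun ⟨m, hm, hx⟩ => ξ.subM_mono (hmono hm.le) hx⟩
    have : Nonempty (Set.Iio l) := ⟨⊥, hl.bot_lt⟩
    simp only [hlim l hl] at hx
    obtain ⟨m, hm⟩ := ξ.mem_subM_iUnion
      (hmono.comp (Subtype.mono_coe _)).directed_le hx
    exact ⟨m, m.2, hm⟩
  · rw [hα, ξ.subM_univ]
  · exact (hind l).quotient_isCountablyGenerated_isWSplit (hind _) (hmono le_self_add)
      (hcount l hl)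

theorem WSplitPresentation.isFilteredByWCGWProjective (ξ : WSplitPresentation R M)
    (hw : IsWModule R M) : IsFilteredByWCGWProjective R M := by
  have hM := (isWModule_iff.1 hw).1
  obtain ⟨α, Hs, hmono, h0, hα, hlim, hind, hcount⟩ := ξ.exists_filtration
  refine ⟨α, fun l => gvClosure (ξ.subM (Hs l)), ⟨?_, fun l _ => ?_, ?_⟩, ?_,
    fun l _ => ⟨?_, ?_⟩, fun l hl => ?_⟩
  · simp only [h0, ξ.subM_empty]
    exact hM
  · exact gvClosure_mono (ξ.subM_mono (hmono le_self_add))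
  · intro l _ hl x
    refine ⟨fun hx => ?_, fun ⟨m, hm, hx⟩ => gvClosure_mono (ξ.subM_mono (hmono hm.le)) hx⟩
    have : Nonempty (Set.Iio l) := ⟨⊥, hl.bot_lt⟩
    have hdir : Directed (· ≤ ·) fun m : Set.Iio l => Hs m :=
      (hmono.comp (Subtype.mono_coe _)).directed_le
    -- A GV-ideal has finitely many generators, so GV-closure commutes with this directed union.
    obtain ⟨m, hm⟩ := mem_gvClosure_of_directed
      (hdir.mono_comp (g := ξ.subM) _ fun _ _ h => ξ.subM_mono h)
      (fun y hy => ξ.mem_subM_iUnion hdir (by rwa [← hlim l hl])) hx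
    exact ⟨m, m.2, hm⟩
  · simp only [hα, ξ.subM_univ]
    exact top_le_iff.1 (le_gvClosure _)
  · exact (hind l).hasWSplitting_gvClosure.isWProjective
      (hM.of_injective _ (Submodule.injective_subtype _))
  · exact hw.of_gvClosure_le (gvClosure_idem _).le
  · exact (hind l).quotient_gvClosure (hind _) (hmono le_self_add) (hcount l hl)

end Main

end WKaplansky

/-- The `w`-version of Kaplansky's theorem. -/
theorem theorem3p5 {R : Type u} [CommRing R] {M : Type u} [AddCommGroup M] [Module R M]
    (hproj : WKaplansky.IsWProjective R M) (hw : WKaplansky.IsWModule R M) :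
    (Nonempty (WKaplansky.WSplitPresentation R M) ∧
      ∀ ξ : WKaplansky.WSplitPresentation R M, ξ.IsFilteredByCGWSplit ⊤) ∧
    WKaplansky.IsFilteredByWCGWProjective R M := by
  obtain ⟨ξ⟩ := hproj.nonempty_wSplitPresentation hw
  exact ⟨⟨⟨ξ⟩, fun ξ => ξ.isFilteredByCGWSplit_top⟩, ξ.isFilteredByWCGWProjective hw⟩
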